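/- Let $\mathcal X,\mathcal Y$ be finite sets and $f:\mathcal X\times\mathcal Y\to\{0,1\}$ a (total) Boolean function. Write $M_f=(f(x,y))_{x,y}$ for its $\{0,1\}$-valued communication matrix and $M_f^{\pm}=2M_f-J$, with $J$ the all-ones matrix, for its $\{-1,1\}$-valued communication matrix (with $1\mapsto 1$, $0\mapsto -1$). For a real matrix $M$ let $$\gamma_2(M)=\min_{A,B:\,AB=M}\lVert A\rVert_r\lVert B\rVert_c ,$$ where $\lVert A\rVert_r$ is the maximum $\ell_2$ norm of a row of $A$ and $\lVert B\rVert_c$ is the maximum $\ell_2$ norm of a column of $B$. For $0<\epsilon<1/2$ let $R^{\mathrm{pub}}_{=\epsilon}(f)$ be the public-coin randomized communication complexity of $f$ with oblivious and exact error $\epsilon$, i.e. the least $c$ such that some probability distribution over deterministic two-party protocols, each exchanging at most $c$ bits in the worst case, accepts every $1$-input of $f$ with probability exactly $1-\epsilon$ and every $0$-input of $f$ with probability exactly $\epsilon$. Logarithms are to base $2$. Fix $\epsilon\in(0,1/2)$. Then the following hold. 1. (Lower bound.) For all finite $\mathcal X,\mathcal Y$ and all $f:\mathcal X\times\mathcal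 Y\to\{0,1\}$: if $\epsilon\le 1/3$, then $\log\gamma_2(M_f)\le R^{\mathrm{pub}}_{=\epsilon}(f)$; if $\epsilon\le 1/4$, then $\log\gamma_2(M_f^{\pm})\le R^{\mathrm{pub}}_{=\epsilon}(f)$; and without a further restriction on $\epsilon$, both $\log\gamma_2(M_f)$ and $\log\gamma_2(M_f^{\pm})$ are at most $R^{\mathrm{pub}}_{=\epsilon}(f)+\log\frac1{1-2\epsilon}$. (If $\gamma_2=0$, the inequalities are read as trivially true.) 2. (Upper bound.) There is a constant $C>0$, depending only on $\epsilon$, such that for all finite $\mathcal X,\mathcal Y$ and all $f:\mathcal X\times\mathcal Y\to\{0,1\}$, $$R^{\mathrm{pub}}_{=\epsilon}(f)\le C\,\gamma_2(M_f)^2\quad\text{and}\quad R^{\mathrm{pub}}_{=\epsilon}(f)\le C\,\gamma_2(M_f^{\pm})^2 .$$ -/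

import Mathlib

universe u v

/-- Deterministic two-party protocol trees: leaves carry the output bit (`true` = accept); at an
internal node one player sends one bit depending on its own input. The bit `false` leads to the
first subtree and the bit `true` to the second one. -/
inductive Protocol (X : Type*) (Y : Type*) where
  | leaf (out : Bool) : Protocol X Y
  | alice (msg : X → Bool) (l r : Protocol X Y) : Protocol X Y
  | bob (msg : Y → Bool) (l r : Protocol X Y) : Protocol X Y

namespace Protocol

/-- The output of the protocol on input `(x, y)`. -/
def run {X Y : Type*} : Protocol X Y → X → Y → Bool
  | leaf b, _, _ => b
  | alice m l r, x, y => if m x then r.run x y else l.run x y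
  | bob m l r, x, y => if m y then r.run x y else l.run x y

/-- The cost of a protocol: the height of the tree, that is, the number of bits exchanged in the
worst case. -/
def cost {X Y : Type*} : Protocol X Y → ℕ
  | leaf _ => 0
  | alice _ l r => max l.cost r.cost + 1
  | bob _ l r => max l.cost r.cost + 1

end Protocol

/-- A public-coin protocol is a probability distribution over deterministic protocols. This is the
probability that it accepts the input `(x, y)`. -/
noncomputable def acceptProb {X Y : Type*} (P : PMF (Protocol X Y)) (x : X) (y : Y) : ℝ :=
  ((P.map fun π => π.run x y) true).toReal

/-- The public-coin protocol `P` computes `f` with oblivious error exactly `ε`: every 1-input is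
accepted with probability exactly `1 - ε`, every 0-input with probability exactly `ε`. -/
def ComputesExactly {X Y : Type*} (ε : ℝ) (f : X → Y → Bool) (P : PMF (Protocol X Y)) : Prop :=
  ∀ x y, acceptProb P x y = if f x y then 1 - ε else ε

/-- The numbers `c` such that some public-coin protocol, all of whose deterministic protocols
exchange at most `c` bits, computes `f` with oblivious error exactly `ε`. -/
def obliviousCosts {X Y : Type*} (ε : ℝ) (f : X → Y → Bool) : Set ℕ :=
  {c | ∃ P : PMF (Protocol X Y), (∀ π ∈ P.support, π.cost ≤ c) ∧ ComputesExactly ε f P}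

/-- The public-coin randomized communication complexity of `f` with oblivious error exactly `ε`.
The minimum is over a nonempty set, see `obliviousCosts_nonempty`. -/
noncomputable def obliviousR {X Y : Type*} (ε : ℝ) (f : X → Y → Bool) : ℕ :=
  sInf (obliviousCosts ε f)

/-- The maximum Euclidean norm of a row of `A`. -/
noncomputable def rowNorm {m n : Type*} [Fintype n] (A : Matrix m n ℝ) : ℝ :=
  ⨆ i, Real.sqrt (∑ j, A i j ^ 2)

/-- The maximum Euclidean norm of a column of `B`. -/
noncomputable def colNorm {m n : Type*} [Fintype m] (B : Matrix m n ℝ) : ℝ :=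
  ⨆ j, Real.sqrt (∑ i, B i j ^ 2)

/-- The factorization norm `γ₂`: the least value of `rowNorm A * colNorm B` over all factorizations
`A * B = M` through some `ℝᵏ`. -/
noncomputable def gammaTwo {m n : Type*} (M : Matrix m n ℝ) : ℝ :=
  sInf {t | ∃ (k : ℕ) (A : Matrix m (Fin k) ℝ) (B : Matrix (Fin k) n ℝ),
    A * B = M ∧ t = rowNorm A * colNorm B}

/-- The communication matrix of `f`, with entries in `{0, 1}`. -/
def commMatrix {X Y : Type*} (f : X → Y → Bool) : Matrix X Y ℝ :=
  Matrix.of fun x y => if f x y then 1 else 0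

/-- The communication matrix of `f`, with entries in `{-1, 1}`. -/
def signMatrix {X Y : Type*} (f : X → Y → Bool) : Matrix X Y ℝ :=
  Matrix.of fun x y => if f x y then 1 else -1

/-- Every function on a finite domain is computed by some deterministic protocol. -/
theorem exists_protocol {X Y : Type*} [Finite X] (f : X → Y → Bool) :
    ∃ π : Protocol X Y, ∀ x y, π.run x y = f x y := by
  classical
  have := Fintype.ofFinite X
  suffices h : ∀ s : Finset X, ∃ π : Protocol X Y, ∀ x ∈ s, ∀ y, π.run x y = f x y by
    obtain ⟨π, hπ⟩ := h Finset.univ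
    exact ⟨π, fun x y => hπ x (Finset.mem_univ x) y⟩
  intro s
  induction s using Finset.induction_on with
  | empty => exact ⟨.leaf true, by simp⟩
  | insert a s _ ih =>
    obtain ⟨π, hπ⟩ := ih
    refine ⟨.alice (fun x => decide (x = a)) π (.bob (f a) (.leaf false) (.leaf true)), ?_⟩
    intro x hx y
    by_cases hxa : x = a
    · subst hxa
      cases h : f x y <;> simp [Protocol.run, h]
    · have hxs : x ∈ s := by simpa [hxa] using hx
      simp [Protocol.run, hxa, hπ x hxs y]

/-- On finite domains some public-coin protocol has oblivious error exactly `ε`. -/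
theorem obliviousCosts_nonempty {X Y : Type*} [Finite X] (ε : ℝ) (h0 : 0 ≤ ε) (h1 : ε ≤ 1)
    (f : X → Y → Bool) : (obliviousCosts ε f).Nonempty := by
  obtain ⟨π, hπ⟩ := exists_protocol f
  obtain ⟨ρ, hρ⟩ := exists_protocol fun x y => !f x y
  let e : ENNReal := ENNReal.ofReal ε
  have he : e ≤ 1 := by simpa [e] using h1
  have hsum : ∑ b : Bool, (if b then 1 - e else e) = 1 := by
    simp [tsub_add_cancel_of_le he]
  let Q : PMF Bool := PMF.ofFintype (fun b => if b then 1 - e else e) hsum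
  refine ⟨max π.cost ρ.cost, Q.map (fun b => if b then π else ρ), ?_, ?_⟩
  · intro σ hσ
    rw [PMF.mem_support_map_iff] at hσ
    obtain ⟨b, _, rfl⟩ := hσ
    cases b <;> simp
  · have hfun : (1 - e).toReal = 1 - ε := by
      rw [ENNReal.toReal_sub_of_le he ENNReal.one_ne_top]
      simp [e, ENNReal.toReal_ofReal h0]
    intro x y
    unfold acceptProb
    rw [PMF.map_comp, PMF.map_apply, tsum_fintype]
    cases h : f x y <;> simp [hπ, hρ, h, Q, hfun] <;>
      simp [e, ENNReal.toReal_ofReal h0]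

/-! Public-coin protocols of cost at most `c` realise exactly the convex hull of the deterministic
acceptance matrices (`acceptProb_mem_acceptHull`, `exists_acceptProb_of_mem_acceptHull`), so both
bounds compare this hull with the unit ball of `γ₂`.

Lower bound: if `A` is the acceptance matrix of an exact protocol, then `2A - J = (1 - 2ε) M_f^±`.
Each bit at most doubles `γ₂` of the sign matrix of a protocol, and the last bit is free because a
one-bit protocol has rank one. Hence `γ₂(M_f^±) ≤ 2^(c-1) / (1 - 2ε)` for `c ≥ 1`; the saved factor
2 is what absorbs `1 / (1 - 2ε)` for small `ε`.

Upper bound: Grothendieck's inequality with constant 200 (`HasGamma.div_mem_signHull`) writes `M_f^±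
/ (200 t)` as a convex combination of rank-one sign matrices. Sampling one of these and comparing
two signs costs 2 bits and has bias exactly `±η`, `η = 1 / (200 t)`. A majority over `O(1/(ε η²))`
rounds has error at most `ε` by Chebyshev (`le_walkProb`, `walkProb_le`). Its acceptance probability
depends only on `f(x,y)`, so adding noise to the output makes the error exactly `ε`
(`exactMatrix_mem_acceptHull_of_gap`). -/

/-! ### Calculus of the factorization norm -/

/-- `M` factors as a matrix of inner products of vectors of squared norm at most `t`. -/
def HasGamma {X Y : Type*} (M : X → Y → ℝ) (t : ℝ) : Prop :=
  ∃ (k : ℕ) (A : X → Fin k → ℝ) (B : Y → Fin k → ℝ), (∀ x y, M x y = ∑ i, A x i * B y i) ∧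
    (∀ x, ∑ i, A x i ^ 2 ≤ t) ∧ ∀ y, ∑ i, B y i ^ 2 ≤ t

namespace HasGamma

variable {X Y : Type*}

theorem of_fintype {ι : Type*} [Fintype ι] {M : X → Y → ℝ} {t : ℝ} (A : X → ι → ℝ)
    (B : Y → ι → ℝ) (hM : ∀ x y, M x y = ∑ i, A x i * B y i) (hA : ∀ x, ∑ i, A x i ^ 2 ≤ t)
    (hB : ∀ y, ∑ i, B y i ^ 2 ≤ t) : HasGamma M t := by
  let e := (Fintype.equivFin ι).symm
  refine ⟨Fintype.card ι, fun x i => A x (e i), fun y i => B y (e i), fun x y => ?_, fun x => ?_,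
    fun y => ?_⟩
  · rw [hM]; exact (e.sum_comp fun i => A x i * B y i).symm
  · rw [e.sum_comp fun i => A x i ^ 2]; exact hA x
  · rw [e.sum_comp fun i => B y i ^ 2]; exact hB y

/-- Rescaling an unbalanced factorization. -/
theorem of_unbalanced {ι : Type*} [Fintype ι] {M : X → Y → ℝ} {r c t : ℝ} (hr : 0 < r)
    (ht : 0 < t) (h : r * c ≤ t ^ 2) (A : X → ι → ℝ) (B : Y → ι → ℝ)
    (hM : ∀ x y, M x y = ∑ i, A x i * B y i) (hA : ∀ x, ∑ i, A x i ^ 2 ≤ r)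
    (hB : ∀ y, ∑ i, B y i ^ 2 ≤ c) : HasGamma M t := by
  have hs : Real.sqrt (t / r) ^ 2 = t / r := Real.sq_sqrt (by positivity)
  have hs0 : 0 < Real.sqrt (t / r) := Real.sqrt_pos.2 (by positivity)
  set s := Real.sqrt (t / r)
  refine of_fintype (fun x i => s * A x i) (fun y i => B y i / s) (fun x y => ?_) (fun x => ?_)
    fun y => ?_
  · rw [hM]
    refine Finset.sum_congr rfl fun i _ => ?_
    field_simp
  · simp only [mul_pow, ← Finset.mul_sum, hs]
    calc t / r * ∑ i, A x i ^ 2 ≤ t / r * r := by gcongr; exact hA x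
      _ = t := by field_simp
  · simp only [div_pow, ← Finset.sum_div, hs]
    rw [div_div_eq_mul_div, div_le_iff₀ ht]
    nlinarith [hB y]

theorem mono {M : X → Y → ℝ} {s t : ℝ} (h : HasGamma M s) (hst : s ≤ t) : HasGamma M t := by
  obtain ⟨k, A, B, hM, hA, hB⟩ := h
  exact ⟨k, A, B, hM, fun x => (hA x).trans hst, fun y => (hB y).trans hst⟩

theorem congr {M N : X → Y → ℝ} {t : ℝ} (h : HasGamma M t) (hMN : ∀ x y, N x y = M x y) :
    HasGamma N t := by
  have : N = M := funext fun x => funext fun y => hMN x y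
  exact this ▸ h

/-- Concatenating the vectors of the two factorizations adds both inner products and squared norms.
-/
theorem add {M N : X → Y → ℝ} {s t : ℝ} (h : HasGamma M s) (h' : HasGamma N t) :
    HasGamma (fun x y => M x y + N x y) (s + t) := by
  obtain ⟨k, A, B, hM, hA, hB⟩ := h
  obtain ⟨l, C, D, hN, hC, hD⟩ := h'
  refine of_fintype (fun x => Sum.elim (A x) (C x)) (fun y => Sum.elim (B y) (D y))
    (fun x y => ?_) (fun x => ?_) fun y => ?_
  · simp [hM, hN]
  · simpa using add_le_add (hA x) (hC x)
  · simpa using add_le_add (hB y) (hD y)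

theorem const_mul {M : X → Y → ℝ} {t a : ℝ} (ha : 0 ≤ a) (h : HasGamma M t) :
    HasGamma (fun x y => a * M x y) (a * t) := by
  obtain ⟨k, A, B, hM, hA, hB⟩ := h
  refine ⟨k, fun x i => Real.sqrt a * A x i, fun y i => Real.sqrt a * B y i, fun x y => ?_,
    fun x => ?_, fun y => ?_⟩
  · simp only [hM, Finset.mul_sum]
    refine Finset.sum_congr rfl fun i _ => ?_
    linear_combination (-(A x i * B y i)) * Real.mul_self_sqrt ha
  · simp only [mul_pow, ← Finset.mul_sum, Real.sq_sqrt ha]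
    exact mul_le_mul_of_nonneg_left (hA x) ha
  · simp only [mul_pow, ← Finset.mul_sum, Real.sq_sqrt ha]
    exact mul_le_mul_of_nonneg_left (hB y) ha

theorem rankOne (a : X → ℝ) (b : Y → ℝ) (ha : ∀ x, |a x| ≤ 1) (hb : ∀ y, |b y| ≤ 1) :
    HasGamma (fun x y => a x * b y) 1 :=
  ⟨1, fun x _ => a x, fun y _ => b y, fun x y => by simp,
    fun x => by simpa using ha x, fun y => by simpa using hb y⟩

theorem mask {M : X → Y → ℝ} {t : ℝ} (a : X → ℝ) (b : Y → ℝ) (ha : ∀ x, |a x| ≤ 1)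
    (hb : ∀ y, |b y| ≤ 1) (h : HasGamma M t) : HasGamma (fun x y => a x * b y * M x y) t := by
  obtain ⟨k, A, B, hM, hA, hB⟩ := h
  refine ⟨k, fun x i => a x * A x i, fun y i => b y * B y i, fun x y => ?_, fun x => ?_,
    fun y => ?_⟩
  · simp only [hM, Finset.mul_sum]
    exact Finset.sum_congr rfl fun i _ => by ring
  · simp only [mul_pow, ← Finset.mul_sum]
    exact (mul_le_of_le_one_left (by positivity) ((sq_le_one_iff_abs_le_one _).2 (ha x))).trans
      (hA x)
  · simp only [mul_pow, ← Finset.mul_sum]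
    exact (mul_le_of_le_one_left (by positivity) ((sq_le_one_iff_abs_le_one _).2 (hb y))).trans
      (hB y)

theorem abs_le {M : X → Y → ℝ} {t : ℝ} (h : HasGamma M t) (x : X) (y : Y) : |M x y| ≤ t := by
  obtain ⟨k, A, B, hM, hA, hB⟩ := h
  have h1 : ∑ i, A x i * B y i ≤ ∑ i, (A x i ^ 2 + B y i ^ 2) / 2 :=
    Finset.sum_le_sum fun i _ => by nlinarith [sq_nonneg (A x i - B y i)]
  have h2 : ∑ i, -(A x i * B y i) ≤ ∑ i, (A x i ^ 2 + B y i ^ 2) / 2 :=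
    Finset.sum_le_sum fun i _ => by nlinarith [sq_nonneg (A x i + B y i)]
  rw [← Finset.sum_div, Finset.sum_add_distrib] at h1 h2
  rw [Finset.sum_neg_distrib] at h2
  rw [hM, _root_.abs_le]
  constructor <;> linarith [hA x, hB y]

theorem gammaTwo_le {M : X → Y → ℝ} {t : ℝ} (ht : 0 ≤ t) (h : HasGamma M t) :
    gammaTwo (Matrix.of M) ≤ t := by
  obtain ⟨k, A, B, hM, hA, hB⟩ := h
  have hr : rowNorm (Matrix.of A) ≤ Real.sqrt t :=
    Real.iSup_le (fun x => Real.sqrt_le_sqrt (hA x)) (Real.sqrt_nonneg t)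
  have hc : colNorm (Matrix.of fun i y => B y i) ≤ Real.sqrt t :=
    Real.iSup_le (fun y => Real.sqrt_le_sqrt (hB y)) (Real.sqrt_nonneg t)
  have hr0 : 0 ≤ colNorm (Matrix.of fun i y => B y i) :=
    Real.iSup_nonneg fun y => Real.sqrt_nonneg _
  calc gammaTwo (Matrix.of M)
      ≤ rowNorm (Matrix.of A) * colNorm (Matrix.of fun i y => B y i) := by
        refine csInf_le ⟨0, ?_⟩ ⟨k, _, _, ?_, rfl⟩
        · rintro _ ⟨k, A, B, _, rfl⟩
          exact mul_nonneg (Real.iSup_nonneg fun _ => Real.sqrt_nonneg _)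
            (Real.iSup_nonneg fun _ => Real.sqrt_nonneg _)
        · ext x y
          simp [Matrix.mul_apply, hM]
    _ ≤ Real.sqrt t * Real.sqrt t := mul_le_mul hr hc hr0 (Real.sqrt_nonneg t)
    _ = t := Real.mul_self_sqrt ht

end HasGamma

theorem gammaTwo_nonneg {X Y : Type*} (M : Matrix X Y ℝ) : 0 ≤ gammaTwo M := by
  refine Real.sInf_nonneg ?_
  rintro _ ⟨k, A, B, _, rfl⟩
  exact mul_nonneg (Real.iSup_nonneg fun _ => Real.sqrt_nonneg _)
    (Real.iSup_nonneg fun _ => Real.sqrt_nonneg _)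

theorem sum_sq_le_rowNorm_sq {m n : Type*} [Finite m] [Fintype n] (A : Matrix m n ℝ) (i : m) :
    ∑ j, A i j ^ 2 ≤ rowNorm A ^ 2 := by
  have h : Real.sqrt (∑ j, A i j ^ 2) ≤ rowNorm A :=
    le_ciSup (f := fun i => Real.sqrt (∑ j, A i j ^ 2)) (Set.finite_range _).bddAbove i
  exact (Real.sqrt_le_left (le_trans (Real.sqrt_nonneg _) h)).1 h

theorem sum_sq_le_colNorm_sq {m n : Type*} [Fintype m] [Finite n] (B : Matrix m n ℝ) (j : n) :
    ∑ i, B i j ^ 2 ≤ colNorm B ^ 2 :=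
  sum_sq_le_rowNorm_sq B.transpose j

/-- The strict inequality makes it unnecessary to know that the infimum is attained. -/
theorem hasGamma_of_gammaTwo_lt {X Y : Type*} [Finite X] [Finite Y] {M : Matrix X Y ℝ} {t : ℝ}
    (h : gammaTwo M < t) : HasGamma M t := by
  classical
  have := Fintype.ofFinite Y
  have ht : 0 < t := (gammaTwo_nonneg M).trans_lt h
  obtain ⟨_, ⟨k, A, B, hM, rfl⟩, hlt⟩ := exists_lt_of_csInf_lt (by
    let e := (Fintype.equivFin Y).symm
    refine ⟨_, Fintype.card Y, M.submatrix id e, (1 : Matrix Y Y ℝ).submatrix e id, ?_, rfl⟩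
    rw [Matrix.submatrix_mul_equiv]
    simp) h
  have hM' : ∀ x y, M x y = ∑ i, A x i * B i y := fun x y => by rw [← hM, Matrix.mul_apply]
  have hA := sum_sq_le_rowNorm_sq A
  have hB := sum_sq_le_colNorm_sq B
  have hr : 0 ≤ rowNorm A := Real.iSup_nonneg fun _ => Real.sqrt_nonneg _
  have hc : 0 ≤ colNorm B := Real.iSup_nonneg fun _ => Real.sqrt_nonneg _
  -- Balancing divides by the row norm; if that vanishes, `M = 0` and the empty factorization
  -- serves.
  rcases hr.eq_or_lt with hr | hr
  · have hA0 : ∀ x i, A x i = 0 := fun x i => by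
      have h1 := Finset.single_le_sum (f := fun i => A x i ^ 2) (fun i _ => sq_nonneg _)
        (Finset.mem_univ i)
      have h2 := hA x
      rw [← hr] at h2
      exact pow_eq_zero_iff two_ne_zero |>.1 (le_antisymm (by simpa using h1.trans h2)
        (sq_nonneg _))
    exact ⟨0, fun _ => Fin.elim0, fun _ => Fin.elim0, fun x y => by simp [hM', hA0],
      fun x => by simpa using ht.le, fun y => by simpa using ht.le⟩
  · refine HasGamma.of_unbalanced (pow_pos hr 2) ht ?_ A (fun y i => B i y) hM' hA hB
    rw [← mul_pow]
    gcongr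

/-! ### Rademacher sums and Grothendieck's inequality -/

/-- The sign of a bit. -/
def signOf (b : Bool) : ℝ := if b then 1 else -1

/-- The Rademacher sum with coefficients `u`. -/
def rademacher {n : ℕ} (u : Fin n → ℝ) (s : Fin n → Bool) : ℝ := ∑ i, u i * signOf (s i)

theorem sum_bool_cons {n : ℕ} (F : (Fin (n + 1) → Bool) → ℝ) :
    ∑ s, F s = ∑ s : Fin n → Bool, (F (Fin.cons true s) + F (Fin.cons false s)) := by
  rw [← (Fin.consEquiv fun _ => Bool).sum_comp, Fintype.sum_prod_type, Fintype.sum_bool,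
    ← Finset.sum_add_distrib]
  rfl

theorem rademacher_cons {n : ℕ} (u : Fin (n + 1) → ℝ) (b : Bool) (s : Fin n → Bool) :
    rademacher u (Fin.cons b s) = u 0 * signOf b + rademacher (fun i => u i.succ) s := by
  simp [rademacher, Fin.sum_univ_succ]

/-- Independent signs are orthonormal, so an inner product is the expectation of a product of
Rademacher sums. They replace Gaussians and keep every expectation a finite sum. -/
theorem sum_rademacher_mul {n : ℕ} (u v : Fin n → ℝ) :
    ∑ s, rademacher u s * rademacher v s = 2 ^ n * ∑ i, u i * v i := by
  induction n with
  | zero => simp [rademacher]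
  | succ n ih =>
    rw [sum_bool_cons, Fin.sum_univ_succ]
    have h : ∀ s : Fin n → Bool,
        rademacher u (Fin.cons true s) * rademacher v (Fin.cons true s) +
          rademacher u (Fin.cons false s) * rademacher v (Fin.cons false s) =
        2 * (u 0 * v 0) +
          2 * (rademacher (fun i => u i.succ) s * rademacher (fun i => v i.succ) s) := fun s => by
      simp only [rademacher_cons, signOf]
      norm_num
      ring
    simp only [h, Finset.sum_add_distrib, ← Finset.mul_sum, ih]
    simp
    ring

/-- Averaging over the first sign turns the fourth moment into `a⁴ + 6a²σ + E T⁴`, where `a = u 0`,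
`T` is the remaining sum and `σ = E T²`. With `E T⁴ ≤ 3σ²` this is at most `3(a² + σ)²`. -/
theorem sum_rademacher_pow_four_le {n : ℕ} (u : Fin n → ℝ) :
    ∑ s, rademacher u s ^ 4 ≤ 2 ^ n * (3 * (∑ i, u i ^ 2) ^ 2) := by
  induction n with
  | zero => simp [rademacher]
  | succ n ih =>
    rw [sum_bool_cons, Fin.sum_univ_succ]
    have h : ∀ s : Fin n → Bool,
        rademacher u (Fin.cons true s) ^ 4 + rademacher u (Fin.cons false s) ^ 4 =
        2 * u 0 ^ 4 + 12 * u 0 ^ 2 *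
          (rademacher (fun i => u i.succ) s * rademacher (fun i => u i.succ) s) +
          2 * rademacher (fun i => u i.succ) s ^ 4 := fun s => by
      simp only [rademacher_cons, signOf]
      norm_num
      ring
    simp only [h, Finset.sum_add_distrib, ← Finset.mul_sum, sum_rademacher_mul]
    have := ih fun i => u i.succ
    have h0 : 0 ≤ (2 : ℝ) ^ n * u 0 ^ 4 := by positivity
    simp only [← sq]
    simp
    rw [pow_succ (2 : ℝ) n]
    nlinarith

/-- Matrices that are convex combinations of sign matrices of rank one. -/
def signHull (X Y : Type*) : Set (X → Y → ℝ) :=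
  convexHull ℝ (Set.range fun p : (X → Bool) × (Y → Bool) => fun x y =>
    signOf (p.1 x) * signOf (p.2 y))

theorem mem_convexHull_signs {X : Type*} [Finite X] (a : X → ℝ) (ha : ∀ x, |a x| ≤ 1) :
    a ∈ convexHull ℝ (Set.range fun (p : X → Bool) x => signOf (p x)) := by
  have h : a ∈ convexHull ℝ (Set.univ.pi fun _ : X => ({-1, 1} : Set ℝ)) := by
    rw [convexHull_pi]
    intro x _
    rw [convexHull_pair, segment_eq_Icc (by norm_num)]
    exact abs_le.1 (ha x)
  refine convexHull_mono ?_ h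
  intro b hb
  refine ⟨fun x => decide (b x = 1), funext fun x => ?_⟩
  rcases hb x trivial with h | h
  · simp only [signOf, h]; norm_num
  · simp only [Set.mem_singleton_iff] at h; simp [signOf, h]

/-- The cube is the convex hull of its vertices; by bilinearity this is applied to each factor
separately. -/
theorem rankOne_mem_signHull {X Y : Type*} [Finite X] [Finite Y] (a : X → ℝ) (b : Y → ℝ)
    (ha : ∀ x, |a x| ≤ 1) (hb : ∀ y, |b y| ≤ 1) : (fun x y => a x * b y) ∈ signHull X Y := by
  have hK : Convex ℝ (signHull X Y) := convex_convexHull ℝ _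
  let L : (X → ℝ) →ₗ[ℝ] (Y → ℝ) →ₗ[ℝ] X → Y → ℝ :=
    LinearMap.mk₂ ℝ (fun a b x y => a x * b y) (fun _ _ _ => by ext; simp [add_mul])
      (fun _ _ _ => by ext; simp [mul_assoc]) (fun _ _ _ => by ext; simp [mul_add])
      (fun _ _ _ => by ext; simp [mul_left_comm])
  have h1 : ∀ p : X → Bool, L (fun x => signOf (p x)) b ∈ signHull X Y := fun p =>
    convexHull_min (t := (L fun x => signOf (p x)) ⁻¹' signHull X Y)
      (by rintro _ ⟨q, rfl⟩; exact subset_convexHull ℝ _ ⟨(p, q), rfl⟩)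
      (hK.linear_preimage _) (mem_convexHull_signs b hb)
  exact convexHull_min (t := (L.flip b) ⁻¹' signHull X Y)
    (by rintro _ ⟨p, rfl⟩; exact h1 p) (hK.linear_preimage _) (mem_convexHull_signs a ha)

/-- Replace values of absolute value above `10` by zero. -/
noncomputable def clip (z : ℝ) : ℝ := if |z| ≤ 10 then z else 0

theorem abs_clip_le (z : ℝ) : |clip z / 10| ≤ 1 := by
  unfold clip
  split_ifs with h
  · rw [abs_div, div_le_one (by norm_num)]; norm_num; exact h
  · simp

theorem clip_sq_le (z : ℝ) : clip z ^ 2 ≤ z ^ 2 := by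
  unfold clip
  split_ifs
  · rfl
  · simpa using sq_nonneg z

/-- Where clipping acts, `z² > 100`, so the fourth moment controls the second moment of the tail. -/
theorem sub_clip_sq_le (z : ℝ) : (z - clip z) ^ 2 ≤ z ^ 4 / 100 := by
  unfold clip
  split_ifs with h
  · have : 0 ≤ z ^ 4 / 100 := by positivity
    simpa using this
  · have : 10 ^ 2 ≤ |z| ^ 2 := by gcongr; exact (not_le.1 h).le
    rw [sq_abs] at this
    nlinarith [sq_nonneg z]

section Truncation

variable {n : ℕ} {u : Fin n → ℝ}

theorem sum_rademacher_sq_le (hu : ∑ i, u i ^ 2 ≤ 1) : ∑ s, rademacher u s ^ 2 ≤ 2 ^ n := by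
  simp only [sq] at hu
  simp only [sq, sum_rademacher_mul]
  exact mul_le_of_le_one_right (by positivity) hu

theorem sum_clip_rademacher_sq_le (hu : ∑ i, u i ^ 2 ≤ 1) :
    ∑ s, clip (rademacher u s) ^ 2 ≤ 2 ^ n :=
  (Finset.sum_le_sum fun _ _ => clip_sq_le _).trans (sum_rademacher_sq_le hu)

theorem sum_sub_clip_rademacher_sq_le (hu : ∑ i, u i ^ 2 ≤ 1) :
    ∑ s, (rademacher u s - clip (rademacher u s)) ^ 2 ≤ 2 ^ n * (3 / 100) := by
  refine (Finset.sum_le_sum fun _ _ => sub_clip_sq_le _).trans ?_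
  rw [← Finset.sum_div]
  have h1 := sum_rademacher_pow_four_le u
  have h2 : (∑ i, u i ^ 2) ^ 2 ≤ 1 := pow_le_one₀ (by positivity) hu
  have h3 : (2 : ℝ) ^ n * (3 * (∑ i, u i ^ 2) ^ 2) ≤ 2 ^ n * (3 * 1) := by gcongr
  linarith

end Truncation

/-- One truncation step in the proof of Grothendieck's inequality. -/
theorem HasGamma.exists_truncation {X Y : Type*} [Finite X] [Finite Y] {M : X → Y → ℝ}
    (h : HasGamma M 1) : ∃ B ∈ signHull X Y, ∃ M' : X → Y → ℝ, HasGamma M' 1 ∧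
      M = (100 : ℝ) • B + (1 / 2 : ℝ) • M' := by
  obtain ⟨n, A, B, hM, hA, hB⟩ := h
  let U : X → (Fin n → Bool) → ℝ := fun x s => rademacher (A x) s
  let V : Y → (Fin n → Bool) → ℝ := fun y s => rademacher (B y) s
  have hN : (0 : ℝ) < 2 ^ n := by positivity
  have hUV : ∀ x y, M x y = (∑ s, U x s * V y s) / 2 ^ n := fun x y => by
    simp only [U, V, sum_rademacher_mul, hM]
    field_simp
  -- Average the identity `UV = clip U · clip V + clip U · (V - clip V) + (U - clip U) · V`. The
  -- first term is 100 times a product of factors bounded by 1; the other two, doubled, form `M'`.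
  refine ⟨∑ s : Fin n → Bool, ((2 : ℝ) ^ n)⁻¹ • fun x y => clip (U x s) / 10 * (clip (V y s) / 10),
    ?_, fun x y => (∑ s, 2 * (clip (U x s) * (V y s - clip (V y s)))
      + ∑ s, 2 * ((U x s - clip (U x s)) * V y s)) / 2 ^ n, ?_, ?_⟩
  · refine (convex_convexHull ℝ _).sum_mem (fun _ _ => by positivity) ?_ fun s _ =>
      rankOne_mem_signHull _ _ (fun _ => abs_clip_le _) fun _ => abs_clip_le _
    simp
  -- The weights 1/2, 3 and 4, 2/3 give both products the coefficient 2. The normalised squared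
  -- norms are at most 1/4 + 27/100 for rows and 48/100 + 4/9 for columns, both below 1.
  · refine HasGamma.of_unbalanced (ι := (Fin n → Bool) ⊕ (Fin n → Bool)) (r := 2 ^ n)
      (c := (2 ^ n)⁻¹) hN one_pos (by field_simp; norm_num)
      (fun x => Sum.elim (fun s => 1 / 2 * clip (U x s)) fun s => 3 * (U x s - clip (U x s)))
      (fun y => Sum.elim (fun s => 4 / 2 ^ n * (V y s - clip (V y s)))
        fun s => 2 / (3 * 2 ^ n) * V y s) (fun x y => ?_) (fun x => ?_) fun y => ?_
    · simp only [Fintype.sum_sum_type, Sum.elim_inl, Sum.elim_inr, add_div, Finset.sum_div]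
      congr 1
      · exact Finset.sum_congr rfl fun s _ => by field_simp; ring
      · exact Finset.sum_congr rfl fun s _ => by field_simp
    · simp only [Fintype.sum_sum_type, Sum.elim_inl, Sum.elim_inr, mul_pow, ← Finset.mul_sum]
      linarith [sum_clip_rademacher_sq_le (hA x), sum_sub_clip_rademacher_sq_le (hA x)]
    · simp only [Fintype.sum_sum_type, Sum.elim_inl, Sum.elim_inr, mul_pow, ← Finset.mul_sum]
      calc _ ≤ (4 / 2 ^ n : ℝ) ^ 2 * (2 ^ n * (3 / 100)) + (2 / (3 * 2 ^ n)) ^ 2 * 2 ^ n := by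
            gcongr
            · exact sum_sub_clip_rademacher_sq_le (hB y)
            · exact sum_rademacher_sq_le (hB y)
        _ = (48 / 100 + 4 / 9) * (2 ^ n)⁻¹ := by field_simp; norm_num
        _ ≤ _ := mul_le_of_le_one_left (by positivity) (by norm_num)
  · ext x y
    simp only [Pi.add_apply, Pi.smul_apply, Finset.sum_apply, smul_eq_mul, hUV]
    rw [← Finset.mul_sum, ← Finset.sum_add_distrib]
    simp only [Finset.sum_div, Finset.mul_sum, ← Finset.sum_add_distrib]
    refine Finset.sum_congr rfl fun s _ => ?_
    field_simp
    ring

theorem HasGamma.exists_approx {X Y : Type*} [Finite X] [Finite Y] {M : X → Y → ℝ}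
    (h : HasGamma M 1) (n : ℕ) : ∃ B ∈ signHull X Y, ∃ M' : X → Y → ℝ, HasGamma M' 1 ∧
      M = (200 * (1 - (1 / 2) ^ n) : ℝ) • B + ((1 / 2) ^ n : ℝ) • M' := by
  induction n with
  | zero =>
    -- The coefficient of `B` is 0 here; any point of the hull will do.
    obtain ⟨B, hB, -⟩ := h.exists_truncation
    exact ⟨B, hB, M, h, by simp⟩
  | succ n ih =>
    obtain ⟨B, hB, M', hM', rfl⟩ := ih
    obtain ⟨B', hB', M'', hM'', rfl⟩ := hM'.exists_truncation
    have hq : (0 : ℝ) < (1 / 2) ^ n := by positivity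
    have hq1 : ((1 : ℝ) / 2) ^ n ≤ 1 := pow_le_one₀ (by norm_num) (by norm_num)
    set q : ℝ := (1 / 2) ^ n
    have hq2 : ((1 : ℝ) / 2) ^ (n + 1) = q / 2 := by simp only [q, pow_succ]; ring
    rw [hq2]
    have hd : 0 < 1 - q / 2 := by linarith
    have hd' : 2 - q ≠ 0 := by linarith
    -- The coefficients `200(1 - q)` of `B` and `100q` of `B'` add up to `200(1 - q/2)`; these are
    -- their normalised shares.
    refine ⟨((1 - q) / (1 - q / 2)) • B + ((q / 2) / (1 - q / 2)) • B', ?_, M'', hM'', ?_⟩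
    · exact convex_convexHull ℝ _ hB hB' (div_nonneg (by linarith) hd.le) (by positivity)
        (by field_simp; ring)
    · ext x y
      simp only [Pi.add_apply, Pi.smul_apply, smul_eq_mul]
      field_simp
      ring

/-- The remainder in `HasGamma.exists_approx` tends to 0 entrywise, and the hull of finitely many
points is closed. -/
theorem HasGamma.div_mem_signHull {X Y : Type*} [Finite X] [Finite Y] {M : X → Y → ℝ}
    (h : HasGamma M 1) : (fun x y => M x y / 200) ∈ signHull X Y := by
  have hK : IsClosed (signHull X Y) := (Set.finite_range _).isClosed_convexHull ℝ
  choose B hB M' hM' hBM using h.exists_approx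
  refine hK.mem_of_tendsto (b := Filter.atTop) (f := B) ?_ (Filter.Eventually.of_forall hB)
  have hq : Filter.Tendsto (fun n => ((1 : ℝ) / 2) ^ n) Filter.atTop (nhds 0) :=
    tendsto_pow_atTop_nhds_zero_of_lt_one (by norm_num) (by norm_num)
  rw [tendsto_pi_nhds]
  intro x
  rw [tendsto_pi_nhds]
  intro y
  have hM'q : Filter.Tendsto (fun n => ((1 : ℝ) / 2) ^ n * M' n x y) Filter.atTop (nhds 0) := by
    refine squeeze_zero_norm (fun n => ?_) hq
    rw [norm_mul, Real.norm_eq_abs, Real.norm_eq_abs, abs_of_pos (by positivity)]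
    exact mul_le_of_le_one_right (by positivity) ((hM' n).abs_le x y)
  have hlim : Filter.Tendsto (fun n => (M x y - (1 / 2) ^ n * M' n x y) /
      (200 * (1 - (1 / 2) ^ n))) Filter.atTop (nhds ((M x y - 0) / (200 * (1 - 0)))) :=
    (hM'q.const_sub _).div ((hq.const_sub 1).const_mul 200) (by norm_num)
  simp only [sub_zero, mul_one] at hlim
  refine hlim.congr' ?_
  filter_upwards [Filter.eventually_ge_atTop 1] with n hn
  have h1 : ((1 : ℝ) / 2) ^ n < 1 := pow_lt_one₀ (by norm_num) (by norm_num) (by omega)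
  have h2 := congrFun (congrFun (hBM n) x) y
  simp only [Pi.add_apply, Pi.smul_apply, smul_eq_mul] at h2
  rw [div_eq_iff (by linarith)]
  linarith

/-! ### Public-coin protocols as a convex hull -/

namespace Protocol

/-- Run the protocol, then continue with `l` if it rejects and with `r` if it accepts. -/
def graft {X Y : Type*} : Protocol X Y → Protocol X Y → Protocol X Y → Protocol X Y
  | leaf b, l, r => if b then r else l
  | alice m π ρ, l, r => alice m (π.graft l r) (ρ.graft l r)
  | bob m π ρ, l, r => bob m (π.graft l r) (ρ.graft l r)

theorem run_graft {X Y : Type*} (π l r : Protocol X Y) (x : X) (y : Y) :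
    (π.graft l r).run x y = if π.run x y then r.run x y else l.run x y := by
  induction π with
  | leaf b => cases b <;> simp [graft, run]
  | alice m π ρ ihπ ihρ => cases h : m x <;> simp [graft, run, h, ihπ, ihρ]
  | bob m π ρ ihπ ihρ => cases h : m y <;> simp [graft, run, h, ihπ, ihρ]

theorem cost_graft_le {X Y : Type*} (π l r : Protocol X Y) :
    (π.graft l r).cost ≤ π.cost + max l.cost r.cost := by
  induction π with
  | leaf b => cases b <;> simp [graft, cost]
  | alice m π ρ ihπ ihρ => simp only [graft, cost]; omega
  | bob m π ρ ihπ ihρ => simp only [graft, cost]; omega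

/-- The acceptance matrix of a deterministic protocol. -/
def matrix {X Y : Type*} (π : Protocol X Y) (x : X) (y : Y) : ℝ := if π.run x y then 1 else 0

end Protocol

/-- The convex hull of the acceptance matrices of deterministic protocols of cost at most `c`. -/
def acceptHull (X Y : Type*) (c : ℕ) : Set (X → Y → ℝ) :=
  convexHull ℝ (Protocol.matrix '' {π : Protocol X Y | π.cost ≤ c})

section AcceptHull

variable {X Y : Type*}

theorem convex_acceptHull (c : ℕ) : Convex ℝ (acceptHull X Y c) := convex_convexHull ℝ _

theorem Protocol.matrix_mem_acceptHull {π : Protocol X Y} {c : ℕ} (h : π.cost ≤ c) :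
    π.matrix ∈ acceptHull X Y c := subset_convexHull ℝ _ ⟨π, h, rfl⟩

/-- There are infinitely many protocol trees but finitely many functions they compute; pushing `P`
forward to those functions leaves a finite convex combination. -/
theorem acceptProb_mem_acceptHull [Finite X] [Finite Y] {P : PMF (Protocol X Y)} {c : ℕ}
    (hP : ∀ π ∈ P.support, π.cost ≤ c) : acceptProb P ∈ acceptHull X Y c := by
  classical
  have := Fintype.ofFinite X
  have := Fintype.ofFinite Y
  let Q : PMF (X → Y → Bool) := P.map Protocol.run
  have hQ : ∑ g, (Q g).toReal = 1 := by
    rw [← ENNReal.toReal_sum fun g _ => Q.apply_ne_top g,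
      (tsum_fintype _).symm.trans Q.tsum_coe, ENNReal.toReal_one]
  have key := (convex_acceptHull (X := X) (Y := Y) c).finsum_mem
    (w := fun g => (Q g).toReal) (z := fun g x y => if g x y then (1 : ℝ) else 0)
    (fun _ => ENNReal.toReal_nonneg) (by rw [finsum_eq_sum_of_fintype, hQ]) fun g hg => by
      have hg' : g ∈ Q.support := fun h => hg (by simp [h])
      obtain ⟨π, hπ, rfl⟩ := (PMF.mem_support_map_iff _ _ _).1 hg'
      exact Protocol.matrix_mem_acceptHull (hP π hπ)
  convert key using 1
  ext x y
  have : P.map (fun π => π.run x y) = Q.map fun g => g x y := by rw [PMF.map_comp]; rfl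
  rw [acceptProb, this, PMF.map_apply, tsum_fintype, ENNReal.toReal_sum]
  · simp only [finsum_eq_sum_of_fintype, Finset.sum_apply, Pi.smul_apply, smul_eq_mul, mul_ite,
      mul_one, mul_zero]
    refine Finset.sum_congr rfl fun g _ => ?_
    cases g x y <;> simp
  · intro g _
    split_ifs
    · exact Q.apply_ne_top g
    · simp

theorem acceptProb_bind_bool (Q : PMF Bool) (P : Bool → PMF (Protocol X Y)) (x : X) (y : Y) :
    acceptProb (Q.bind P) x y = (Q true).toReal * acceptProb (P true) x y +
      (Q false).toReal * acceptProb (P false) x y := by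
  unfold acceptProb
  rw [PMF.map_bind, PMF.bind_apply, tsum_bool, ENNReal.toReal_add, ENNReal.toReal_mul,
    ENNReal.toReal_mul, add_comm]
  · exact ENNReal.mul_ne_top (Q.apply_ne_top _) (PMF.apply_ne_top _ _)
  · exact ENNReal.mul_ne_top (Q.apply_ne_top _) (PMF.apply_ne_top _ _)

theorem exists_acceptProb_of_mem_acceptHull {c : ℕ} {A : X → Y → ℝ}
    (hA : A ∈ acceptHull X Y c) :
    ∃ P : PMF (Protocol X Y), (∀ π ∈ P.support, π.cost ≤ c) ∧ acceptProb P = A := by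
  refine convexHull_min (t := {A | ∃ P : PMF (Protocol X Y),
    (∀ π ∈ P.support, π.cost ≤ c) ∧ acceptProb P = A}) ?_ ?_ hA
  · rintro _ ⟨π, hπ, rfl⟩
    refine ⟨PMF.pure π, by simpa using hπ, ?_⟩
    ext x y
    rw [acceptProb, PMF.pure_map, PMF.pure_apply, Protocol.matrix]
    cases π.run x y <;> simp
  · rintro _ ⟨P, hP, rfl⟩ _ ⟨P', hP', rfl⟩ a b ha hb hab
    let Q : PMF Bool := PMF.ofFintype (fun t => if t then ENNReal.ofReal a else ENNReal.ofReal b)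
      (by simp [← ENNReal.ofReal_add ha hb, hab])
    refine ⟨Q.bind fun t => if t then P else P', ?_, ?_⟩
    · intro π hπ
      rw [PMF.mem_support_bind_iff] at hπ
      obtain ⟨t, -, ht⟩ := hπ
      cases t
      · exact hP' π ht
      · exact hP π ht
    · ext x y
      rw [acceptProb_bind_bool]
      simp [Q, ha, hb]

theorem const_mem_acceptHull (c : ℕ) {p : ℝ} (h0 : 0 ≤ p) (h1 : p ≤ 1) :
    (fun _ _ => p) ∈ acceptHull X Y c := by
  have h := convex_acceptHull (X := X) (Y := Y) c
    (Protocol.matrix_mem_acceptHull (π := .leaf true) (Nat.zero_le c))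
    (Protocol.matrix_mem_acceptHull (π := .leaf false) (Nat.zero_le c)) h0 (sub_nonneg.2 h1)
    (by ring)
  convert h using 1
  ext x y
  simp [Protocol.matrix, Protocol.run]

/-- Run a protocol, then continue with one of two others depending on its output. -/
theorem branch_mem_acceptHull {c d : ℕ} {A B B' : X → Y → ℝ} (hA : A ∈ acceptHull X Y c)
    (hB : B ∈ acceptHull X Y d) (hB' : B' ∈ acceptHull X Y d) :
    (fun x y => A x y * B x y + (1 - A x y) * B' x y) ∈ acceptHull X Y (c + d) := by
  have hconv := convex_acceptHull (X := X) (Y := Y) (c + d)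
  -- The expression is affine in each of `A`, `B`, `B'` separately, so three nested convexity
  -- arguments reduce to deterministic protocols, where it is a graft.
  refine convexHull_min (t := {A : X → Y → ℝ | (fun x y => A x y * B x y + (1 - A x y) * B' x y) ∈
    acceptHull X Y (c + d)}) ?_ ?_ hA
  · rintro _ ⟨π, hπ, rfl⟩
    refine convexHull_min (t := {B : X → Y → ℝ |
      (fun x y => π.matrix x y * B x y + (1 - π.matrix x y) * B' x y) ∈
      acceptHull X Y (c + d)}) ?_ ?_ hB
    · rintro _ ⟨ρ, hρ, rfl⟩
      refine convexHull_min (t := {B' : X → Y → ℝ |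
        (fun x y => π.matrix x y * ρ.matrix x y + (1 - π.matrix x y) * B' x y) ∈
        acceptHull X Y (c + d)}) ?_ ?_ hB'
      · rintro _ ⟨σ, hσ, rfl⟩
        rw [Set.mem_ofPred_eq]
        convert Protocol.matrix_mem_acceptHull (π := π.graft σ ρ) (c := c + d) ?_ using 1
        · ext x y
          cases h : π.run x y <;> simp [Protocol.matrix, Protocol.run_graft, h]
        · exact (π.cost_graft_le σ ρ).trans (add_le_add hπ (max_le hσ hρ))
      · intro B₁ h₁ B₂ h₂ a b ha hb hab
        rw [Set.mem_ofPred_eq]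
        convert hconv h₁ h₂ ha hb hab using 1
        ext x y
        simp only [Pi.add_apply, Pi.smul_apply, smul_eq_mul]
        linear_combination (-(π.matrix x y * ρ.matrix x y)) * hab
    · intro B₁ h₁ B₂ h₂ a b ha hb hab
      rw [Set.mem_ofPred_eq]
      convert hconv h₁ h₂ ha hb hab using 1
      ext x y
      simp only [Pi.add_apply, Pi.smul_apply, smul_eq_mul]
      linear_combination (-((1 - π.matrix x y) * B' x y)) * hab
  · intro A₁ h₁ A₂ h₂ a b ha hb hab
    rw [Set.mem_ofPred_eq]
    convert hconv h₁ h₂ ha hb hab using 1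
    ext x y
    simp only [Pi.add_apply, Pi.smul_apply, smul_eq_mul]
    linear_combination (-B' x y) * hab

/-- For a vertex, each player sends a sign and the protocol accepts when the two agree. -/
theorem mem_acceptHull_of_mem_signHull {B : X → Y → ℝ} (hB : B ∈ signHull X Y) :
    (fun x y => (1 + B x y) / 2) ∈ acceptHull X Y 2 := by
  refine convexHull_min (t := {B : X → Y → ℝ | (fun x y => (1 + B x y) / 2) ∈
    acceptHull X Y 2}) ?_ ?_ hB
  · rintro _ ⟨⟨a, b⟩, rfl⟩
    rw [Set.mem_ofPred_eq]
    convert Protocol.matrix_mem_acceptHull (c := 2) (π := .alice a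
      (.bob b (.leaf true) (.leaf false)) (.bob b (.leaf false) (.leaf true))) ?_ using 1
    · ext x y
      cases h : a x <;> cases h' : b y <;> simp [Protocol.matrix, Protocol.run, signOf, h, h']
    · simp [Protocol.cost]
  · intro B₁ h₁ B₂ h₂ a b ha hb hab
    rw [Set.mem_ofPred_eq]
    convert convex_acceptHull 2 h₁ h₂ ha hb hab using 1
    ext x y
    simp only [Pi.add_apply, Pi.smul_apply, smul_eq_mul]
    linear_combination (-(1 / 2 : ℝ)) * hab

end AcceptHull

/-! ### Majority of repeated runs as a random walk -/

/-- The probability that a walk of `k` steps `±1`, each upwards with probability `p`, started at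
`s`, ends at a positive number. -/
noncomputable def walkProb : ℕ → ℤ → ℝ → ℝ
  | 0, s, _ => if 0 < s then 1 else 0
  | k + 1, s, p => p * walkProb k (s + 1) p + (1 - p) * walkProb k (s - 1) p

theorem walkProb_mem_acceptHull {X Y : Type*} {c : ℕ} {A : X → Y → ℝ}
    (hA : A ∈ acceptHull X Y c) (k : ℕ) (s : ℤ) :
    (fun x y => walkProb k s (A x y)) ∈ acceptHull X Y (c * k) := by
  induction k generalizing s with
  | zero =>
    unfold walkProb
    split_ifs
    · exact const_mem_acceptHull _ zero_le_one le_rfl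
    · exact const_mem_acceptHull _ le_rfl zero_le_one
  | succ k ih =>
    rw [Nat.mul_succ, add_comm]
    exact branch_mem_acceptHull hA (ih (s + 1)) (ih (s - 1))

theorem walkProb_nonneg {p : ℝ} (h0 : 0 ≤ p) (h1 : p ≤ 1) (k : ℕ) (s : ℤ) :
    0 ≤ walkProb k s p := by
  induction k generalizing s with
  | zero => unfold walkProb; split_ifs <;> simp
  | succ k ih =>
    exact add_nonneg (mul_nonneg h0 (ih (s + 1))) (mul_nonneg (sub_nonneg.2 h1) (ih (s - 1)))

/-- Chebyshev's inequality for a walk with positive drift. -/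
theorem le_walkProb {p m : ℝ} (h0 : 0 ≤ p) (h1 : p ≤ 1) (hm : 0 < m) (k : ℕ) (s : ℤ) :
    1 - ((s + k * (2 * p - 1) - m) ^ 2 + k * (1 - (2 * p - 1) ^ 2)) / m ^ 2 ≤
      walkProb k s p := by
  induction k generalizing s with
  | zero =>
    unfold walkProb
    split_ifs with hs
    · simp; positivity
    · have : (s : ℝ) ≤ 0 := by exact_mod_cast not_lt.1 hs
      rw [sub_nonpos, one_le_div (by positivity)]
      push_cast
      nlinarith
  | succ k ih =>
    have e1 := mul_le_mul_of_nonneg_left (ih (s + 1)) h0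
    have e2 := mul_le_mul_of_nonneg_left (ih (s - 1)) (sub_nonneg.2 h1)
    -- The numerator is the second moment about `m` of the endpoint, so it obeys the recursion of
    -- the walk with equality.
    refine le_trans (le_of_eq ?_) (add_le_add e1 e2)
    push_cast
    ring

/-- Mirror image for negative drift: the indicator of `S > 0` is at most `(S + m)² / m²`. -/
theorem walkProb_le {p m : ℝ} (h0 : 0 ≤ p) (h1 : p ≤ 1) (hm : 0 < m) (k : ℕ) (s : ℤ) :
    walkProb k s p ≤
      ((s + k * (2 * p - 1) + m) ^ 2 + k * (1 - (2 * p - 1) ^ 2)) / m ^ 2 := by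
  induction k generalizing s with
  | zero =>
    unfold walkProb
    split_ifs with hs
    · have : (0 : ℝ) < s := by exact_mod_cast hs
      rw [one_le_div (by positivity)]
      push_cast
      nlinarith
    · simp; positivity
  | succ k ih =>
    have e1 := mul_le_mul_of_nonneg_left (ih (s + 1)) h0
    have e2 := mul_le_mul_of_nonneg_left (ih (s - 1)) (sub_nonneg.2 h1)
    refine (add_le_add e1 e2).trans (le_of_eq ?_)
    push_cast
    ring

/-! ### Lower bound -/

section LowerBound

variable {X Y : Type*}

theorem HasGamma.one_of_abs_le_one_of_left (a : X → ℝ) (ha : ∀ x, |a x| ≤ 1) :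
    HasGamma (fun x (_ : Y) => a x) 1 :=
  (HasGamma.rankOne a (fun _ => 1) ha (by simp)).congr (by simp)

theorem HasGamma.one_of_abs_le_one_of_right (b : Y → ℝ) (hb : ∀ y, |b y| ≤ 1) :
    HasGamma (fun (_ : X) y => b y) 1 :=
  (HasGamma.rankOne (fun _ => 1) b (by simp) hb).congr (by simp)

theorem Protocol.abs_two_mul_matrix_sub_one (π : Protocol X Y) (x : X) (y : Y) :
    |2 * π.matrix x y - 1| ≤ 1 := by
  unfold Protocol.matrix
  split_ifs <;> norm_num

theorem Protocol.eq_leaf_of_cost_eq_zero {π : Protocol X Y} (h : π.cost = 0) :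
    ∃ b, π = .leaf b := by
  cases π with
  | leaf b => exact ⟨b, rfl⟩
  | alice m l r => simp [Protocol.cost] at h
  | bob m l r => simp [Protocol.cost] at h

/-- A message splits the matrix into two disjoint blocks, each a masked copy of a subprotocol's
matrix, so `γ₂` at most doubles. With at most one bit the output depends on one input only, which
gives the base value 1. -/
theorem Protocol.hasGamma (π : Protocol X Y) (c : ℕ) (h : π.cost ≤ c + 1) :
    HasGamma (fun x y => 2 * π.matrix x y - 1) (2 ^ c) := by
  have habs := π.abs_two_mul_matrix_sub_one
  induction c generalizing π with
  | zero =>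
    simp only [pow_zero]
    rcases isEmpty_or_nonempty X with hX | ⟨⟨x₀⟩⟩
    · exact (HasGamma.one_of_abs_le_one_of_right (fun _ => 0) (by simp)).congr
        fun x => hX.elim x
    rcases isEmpty_or_nonempty Y with hY | ⟨⟨y₀⟩⟩
    · exact (HasGamma.one_of_abs_le_one_of_right (fun _ => 0) (by simp)).congr
        fun x y => hY.elim y
    cases π with
    | leaf b =>
      exact (HasGamma.one_of_abs_le_one_of_left _ fun x => habs x y₀).congr
        fun _ _ => rfl
    | alice m l r =>
      simp only [Protocol.cost] at h
      obtain ⟨b, rfl⟩ := l.eq_leaf_of_cost_eq_zero (by omega)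
      obtain ⟨b', rfl⟩ := r.eq_leaf_of_cost_eq_zero (by omega)
      exact (HasGamma.one_of_abs_le_one_of_left _ fun x => habs x y₀).congr fun x y => by
        simp [Protocol.matrix, Protocol.run]
    | bob m l r =>
      simp only [Protocol.cost] at h
      obtain ⟨b, rfl⟩ := l.eq_leaf_of_cost_eq_zero (by omega)
      obtain ⟨b', rfl⟩ := r.eq_leaf_of_cost_eq_zero (by omega)
      exact (HasGamma.one_of_abs_le_one_of_right _ fun y => habs x₀ y).congr fun x y => by
        simp [Protocol.matrix, Protocol.run]
  | succ c ih =>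
    rw [pow_succ, mul_two]
    cases π with
    | leaf b =>
      exact (ih (.leaf b) (by simp [Protocol.cost])
        (Protocol.abs_two_mul_matrix_sub_one _)).mono (by simp)
    | alice m l r =>
      simp only [Protocol.cost] at h
      refine (((ih l (by omega) l.abs_two_mul_matrix_sub_one).mask
        (fun x => if m x then 0 else 1) (fun _ => 1) ?_ (by simp)).add
        ((ih r (by omega) r.abs_two_mul_matrix_sub_one).mask
        (fun x => if m x then 1 else 0) (fun _ => 1) ?_ (by simp))).congr fun x y => ?_
      · intro x; cases m x <;> simp
      · intro x; cases m x <;> simp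
      · cases h : m x <;> simp [Protocol.matrix, Protocol.run, h]
    | bob m l r =>
      simp only [Protocol.cost] at h
      refine (((ih l (by omega) l.abs_two_mul_matrix_sub_one).mask
        (fun _ => 1) (fun y => if m y then 0 else 1) (by simp) ?_).add
        ((ih r (by omega) r.abs_two_mul_matrix_sub_one).mask
        (fun _ => 1) (fun y => if m y then 1 else 0) (by simp) ?_)).congr fun x y => ?_
      · intro y; cases m y <;> simp
      · intro y; cases m y <;> simp
      · cases h : m y <;> simp [Protocol.matrix, Protocol.run, h]

theorem hasGamma_of_mem_acceptHull {c : ℕ} {A : X → Y → ℝ} (hA : A ∈ acceptHull X Y (c + 1)) :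
    HasGamma (fun x y => 2 * A x y - 1) (2 ^ c) := by
  refine convexHull_min (t := {A : X → Y → ℝ | HasGamma (fun x y => 2 * A x y - 1) (2 ^ c)})
    ?_ ?_ hA
  · rintro _ ⟨π, hπ, rfl⟩
    exact π.hasGamma c hπ
  · intro A₁ h₁ A₂ h₂ a b ha hb hab
    refine (((h₁.const_mul ha).add (h₂.const_mul hb)).mono ?_).congr fun x y => ?_
    · rw [← add_mul, hab, one_mul]
    · simp only [Pi.add_apply, Pi.smul_apply, smul_eq_mul]
      linear_combination hab

theorem eq_of_mem_acceptHull_zero {A : X → Y → ℝ} (hA : A ∈ acceptHull X Y 0) (x x' : X)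
    (y y' : Y) : A x y = A x' y' := by
  refine convexHull_min (t := {A : X → Y → ℝ | A x y = A x' y'}) ?_ ?_ hA
  · rintro _ ⟨π, hπ, rfl⟩
    obtain ⟨b, rfl⟩ := π.eq_leaf_of_cost_eq_zero (Nat.le_zero.1 hπ)
    rfl
  · intro A₁ h₁ A₂ h₂ a b ha hb hab
    simp only [Set.mem_ofPred_eq] at h₁ h₂
    simp [h₁, h₂]

/-- The acceptance matrix of a protocol with oblivious error exactly `ε`. -/
def exactMatrix (ε : ℝ) (f : X → Y → Bool) (x : X) (y : Y) : ℝ := if f x y then 1 - ε else ε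

theorem exactMatrix_mem_acceptHull_obliviousR [Finite X] [Finite Y] {ε : ℝ} (h0 : 0 ≤ ε)
    (h1 : ε ≤ 1) (f : X → Y → Bool) : exactMatrix ε f ∈ acceptHull X Y (obliviousR ε f) := by
  obtain ⟨P, hP, hf⟩ := Nat.sInf_mem (obliviousCosts_nonempty ε h0 h1 f)
  have : acceptProb P = exactMatrix ε f := funext fun x => funext fun y => hf x y
  exact this ▸ acceptProb_mem_acceptHull hP

theorem obliviousR_le_of_mem_acceptHull {ε : ℝ} {f : X → Y → Bool} {c : ℕ}
    (h : exactMatrix ε f ∈ acceptHull X Y c) : obliviousR ε f ≤ c := by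
  obtain ⟨P, hP, hf⟩ := exists_acceptProb_of_mem_acceptHull h
  exact Nat.sInf_le ⟨P, hP, fun x y => by rw [hf, exactMatrix]⟩

theorem hasGamma_signMatrix_of_exact {ε t : ℝ} (hε : ε < 1 / 2) {f : X → Y → Bool}
    (h : HasGamma (fun x y => 2 * exactMatrix ε f x y - 1) t) :
    HasGamma (signMatrix f) (t / (1 - 2 * ε)) := by
  have hε' : 0 < 1 - 2 * ε := by linarith
  refine ((h.const_mul (inv_nonneg.2 hε'.le)).mono (by rw [inv_mul_eq_div])).congr fun x y => ?_
  rw [eq_inv_mul_iff_mul_eq₀ hε'.ne']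
  cases h : f x y <;> simp [signMatrix, exactMatrix, h] <;> ring

theorem hasGamma_commMatrix_of_signMatrix {t : ℝ} {f : X → Y → Bool}
    (h : HasGamma (signMatrix f) t) : HasGamma (commMatrix f) ((t + 1) / 2) := by
  refine (((h.add (HasGamma.one_of_abs_le_one_of_left (fun _ => 1) (by simp))).const_mul
    (a := 1 / 2) (by norm_num)).mono (by linarith)).congr fun x y => ?_
  cases h : f x y <;> simp [signMatrix, commMatrix, h]
  norm_num

theorem hasGamma_signMatrix_of_commMatrix {t : ℝ} {f : X → Y → Bool}
    (h : HasGamma (commMatrix f) t) : HasGamma (signMatrix f) (2 * t + 1) := by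
  refine ((h.const_mul (a := 2) (by norm_num)).add
    (HasGamma.one_of_abs_le_one_of_left (fun _ => -1) (by simp))).congr fun x y => ?_
  cases h : f x y <;> simp [signMatrix, commMatrix, h]
  norm_num

theorem hasGamma_signMatrix_one_of_const {f : X → Y → Bool}
    (h : ∀ x x' y y', f x y = f x' y') : HasGamma (signMatrix f) 1 := by
  have : ∃ a : ℝ, |a| ≤ 1 ∧ ∀ x y, signMatrix f x y = a := by
    by_cases hxy : ∃ x y, f x y
    · obtain ⟨x, y, hf⟩ := hxy
      exact ⟨1, by simp, fun x' y' => by simp [signMatrix, h x' x y' y, hf]⟩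
    · push Not at hxy
      exact ⟨-1, by simp, fun x y => by simp [signMatrix, hxy x y]⟩
  obtain ⟨a, ha, hf⟩ := this
  exact (HasGamma.one_of_abs_le_one_of_left (fun _ => a) fun _ => ha).congr hf

theorem logb_gammaTwo_le {M : X → Y → ℝ} {t r : ℝ} (ht : 0 ≤ t) (h : HasGamma M t)
    (hr : 0 ≤ r) (htr : t ≤ 2 ^ r) : Real.logb 2 (gammaTwo (Matrix.of M)) ≤ r := by
  rcases (gammaTwo_nonneg (Matrix.of M)).eq_or_lt with h0 | h0
  -- `Real.logb 2 0 = 0`, which is why `0 ≤ r` is required.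
  · rw [← h0]; simpa
  · rw [Real.logb_le_iff_le_rpow one_lt_two h0]
    exact (h.gammaTwo_le ht).trans htr

theorem logb_gammaTwo_le_obliviousR [Finite X] [Finite Y] {ε : ℝ} (h0 : 0 < ε) (h1 : ε < 1 / 2)
    (f : X → Y → Bool) :
    (ε ≤ 1 / 3 → Real.logb 2 (gammaTwo (commMatrix f)) ≤ (obliviousR ε f : ℝ)) ∧
    (ε ≤ 1 / 4 → Real.logb 2 (gammaTwo (signMatrix f)) ≤ (obliviousR ε f : ℝ)) ∧
    Real.logb 2 (gammaTwo (commMatrix f)) ≤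
      (obliviousR ε f : ℝ) + Real.logb 2 (1 / (1 - 2 * ε)) ∧
    Real.logb 2 (gammaTwo (signMatrix f)) ≤
      (obliviousR ε f : ℝ) + Real.logb 2 (1 / (1 - 2 * ε)) := by
  have hmem := exactMatrix_mem_acceptHull_obliviousR h0.le (by linarith) f
  have hδ : 0 < 1 - 2 * ε := by linarith
  have hδ1 : 1 ≤ 1 / (1 - 2 * ε) := by rw [one_le_div hδ]; linarith
  have hlog : 0 ≤ Real.logb 2 (1 / (1 - 2 * ε)) := Real.logb_nonneg one_lt_two hδ1
  have hpow : ∀ c : ℕ, (2 : ℝ) ^ ((c : ℝ) + Real.logb 2 (1 / (1 - 2 * ε))) =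
      2 ^ c * (1 / (1 - 2 * ε)) := fun c => by
    rw [Real.rpow_add two_pos, Real.rpow_natCast,
      Real.rpow_logb two_pos (by norm_num) (by positivity)]
  generalize hc : obliviousR ε f = c at hmem
  rcases c with _ | c
  -- Without communication there is no free last bit, but `ε ≠ 1 - ε` then forces `f` to be
  -- constant.
  · have hs : HasGamma (signMatrix f) 1 := hasGamma_signMatrix_one_of_const fun x x' y y' => by
      have h := eq_of_mem_acceptHull_zero hmem x x' y y'
      unfold exactMatrix at h
      cases hf : f x y <;> cases hf' : f x' y' <;> simp [hf, hf'] at h ⊢ <;>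
        linarith
    have hm := (hasGamma_commMatrix_of_signMatrix hs).mono (t := 1) (by norm_num)
    have e1 := logb_gammaTwo_le zero_le_one hm le_rfl (by simp)
    have e2 := logb_gammaTwo_le zero_le_one hs le_rfl (by simp)
    rw [Nat.cast_zero, zero_add]
    exact ⟨fun _ => e1, fun _ => e2, e1.trans hlog, e2.trans hlog⟩
  · have hs := hasGamma_signMatrix_of_exact h1 (hasGamma_of_mem_acceptHull hmem)
    have hm := hasGamma_commMatrix_of_signMatrix hs
    have hp : (1 : ℝ) ≤ 2 ^ c := one_le_pow₀ one_le_two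
    have hp' : (2 : ℝ) ^ (((c + 1 : ℕ) : ℝ)) = 2 ^ c * 2 := by rw [Real.rpow_natCast, pow_succ]
    have hs0 : (0 : ℝ) ≤ 2 ^ c / (1 - 2 * ε) := by positivity
    have hm0 : (0 : ℝ) ≤ (2 ^ c / (1 - 2 * ε) + 1) / 2 := by positivity
    have hcast : (0 : ℝ) ≤ ((c + 1 : ℕ) : ℝ) := Nat.cast_nonneg _
    refine ⟨fun hε => logb_gammaTwo_le hm0 hm hcast ?_,
      fun hε => logb_gammaTwo_le hs0 hs hcast ?_,
      logb_gammaTwo_le hm0 hm (by positivity) ?_,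
      logb_gammaTwo_le hs0 hs (by positivity) ?_⟩
    -- Here `1 / (1 - 2ε) ≤ 3`, and `(3 · 2^c + 1) / 2 ≤ 2^(c+1)` because `2^c ≥ 1`.
    · rw [hp']
      have : (2 : ℝ) ^ c / (1 - 2 * ε) ≤ 2 ^ c * 3 := by
        rw [div_le_iff₀ hδ]; nlinarith
      linarith
    · rw [hp', div_le_iff₀ hδ]
      nlinarith
    · rw [hpow, pow_succ, mul_one_div, mul_div_right_comm]
      have : 1 ≤ (2 : ℝ) ^ c / (1 - 2 * ε) := by rw [one_le_div hδ]; linarith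
      linarith
    · rw [hpow, pow_succ, mul_one_div, mul_div_right_comm]
      linarith

end LowerBound

/-! ### Upper bound -/

section UpperBound

variable {X Y : Type*}

theorem obliviousR_eq_zero_of_const {ε : ℝ} (h0 : 0 ≤ ε) (h1 : ε ≤ 1) {f : X → Y → Bool} (b : Bool)
    (h : ∀ x y, f x y = b) : obliviousR ε f = 0 := by
  refine Nat.le_zero.1 (obliviousR_le_of_mem_acceptHull ?_)
  have : exactMatrix ε f = fun _ _ => if b then 1 - ε else ε := by
    ext x y; rw [exactMatrix, h]
  rw [this]
  apply const_mem_acceptHull <;> split_ifs <;> linarith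

/-- The affine map sending `q₀` to `ε` and `q₁` to `1 - ε` has slope at most 1, so it is realised by
replacing the output with a biased coin, at no communication cost. -/
theorem exactMatrix_mem_acceptHull_of_gap {ε q₀ q₁ : ℝ} (h0 : 0 < ε) (h1 : ε < 1 / 2) {c : ℕ}
    {f : X → Y → Bool} {A : X → Y → ℝ} (hA : A ∈ acceptHull X Y c)
    (hf : ∀ x y, A x y = if f x y then q₁ else q₀) (hq₀ : 0 ≤ q₀) (hq₀' : q₀ ≤ ε)
    (hq₁ : 1 - ε ≤ q₁) : exactMatrix ε f ∈ acceptHull X Y c := by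
  have hgap : 0 < q₁ - q₀ := by linarith
  set s := (1 - 2 * ε) / (q₁ - q₀) with hs
  have hs0 : 0 ≤ s := div_nonneg (by linarith) hgap.le
  have hs1 : s ≤ 1 := by rw [hs, div_le_one hgap]; linarith
  have hsq : s * (q₁ - q₀) = 1 - 2 * ε := div_mul_cancel₀ _ hgap.ne'
  have h := branch_mem_acceptHull hA
    (const_mem_acceptHull 0 (p := ε - s * q₀ + s) (by nlinarith) (by nlinarith))
    (const_mem_acceptHull 0 (p := ε - s * q₀) (by nlinarith) (by nlinarith))
  rw [add_zero] at h
  convert h using 1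
  ext x y
  rw [hf, exactMatrix]
  split_ifs
  · linear_combination -hsq
  · ring

theorem one_le_gammaTwo [Finite X] [Finite Y] {M : Matrix X Y ℝ} {x : X} {y : Y}
    (h : |M x y| = 1) : 1 ≤ gammaTwo M :=
  le_of_forall_gt_imp_ge_of_dense fun _ ht => h ▸ (hasGamma_of_gammaTwo_lt ht).abs_le x y

theorem obliviousR_le_of_hasGamma [Finite X] [Finite Y] {ε : ℝ} (h0 : 0 < ε) (h1 : ε < 1 / 2)
    {f : X → Y → Bool} {t : ℝ} (ht : 1 ≤ t) (h : HasGamma (signMatrix f) t) :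
    (obliviousR ε f : ℝ) ≤ (80000 / ε + 2) * t ^ 2 := by
  have ht0 : 0 < t := by linarith
  set η : ℝ := 1 / (200 * t) with hη
  have hη0 : 0 < η := by positivity
  have hη1 : η ≤ 1 := by rw [hη, div_le_one (by positivity)]; linarith
  have hB : (fun x y => signMatrix f x y * η) ∈ signHull X Y := by
    have := ((h.const_mul (inv_nonneg.2 ht0.le)).mono
      (t := 1) (by rw [inv_mul_cancel₀ ht0.ne'])).div_mem_signHull
    convert this using 3
    rw [hη]
    field_simp
  -- With mean displacement `m = kη`, Chebyshev bounds the error by `1 / (kη²)`, hence this number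
  -- of rounds. The final constant is `80000 = 2 · 200²`, plus 2 for the rounding.
  set k : ℕ := ⌈1 / (ε * η ^ 2)⌉₊ with hk
  have hk1 : 1 / (ε * η ^ 2) ≤ k := Nat.le_ceil _
  have hk0 : (0 : ℝ) < k := lt_of_lt_of_le (by positivity) hk1
  have hkε : 1 / (k * η ^ 2) ≤ ε := by
    rw [div_le_iff₀ (by positivity)] at hk1 ⊢
    linarith
  have hm : 0 < k * η := by positivity
  have hmem := walkProb_mem_acceptHull (mem_acceptHull_of_mem_signHull hB) k 0
  have hR := obliviousR_le_of_mem_acceptHull (f := f) (exactMatrix_mem_acceptHull_of_gap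
    (q₀ := walkProb k 0 ((1 - η) / 2)) (q₁ := walkProb k 0 ((1 + η) / 2)) h0 h1 hmem
    (fun x y => ?_) ?_ ?_ ?_)
  · calc (obliviousR ε f : ℝ) ≤ 2 * (k : ℝ) := by exact_mod_cast hR
      _ ≤ 2 * (1 / (ε * η ^ 2) + 1) := by
        have := (Nat.ceil_lt_add_one (a := 1 / (ε * η ^ 2)) (by positivity)).le
        gcongr
      _ = 80000 / ε * t ^ 2 + 2 * 1 := by rw [hη]; field_simp; ring
      _ ≤ 80000 / ε * t ^ 2 + 2 * t ^ 2 := by gcongr; exact one_le_pow₀ ht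
      _ = (80000 / ε + 2) * t ^ 2 := by ring
  · cases hf : f x y <;> simp [signMatrix, hf, sub_eq_add_neg]
  · exact walkProb_nonneg (by linarith) (by linarith) k 0
  · refine (walkProb_le (by linarith) (by linarith) hm k 0).trans (le_trans ?_ hkε)
    rw [div_le_div_iff₀ (by positivity) (by positivity)]
    push_cast
    nlinarith [show 0 ≤ (k : ℝ) ^ 2 * η ^ 4 by positivity]
  · refine le_trans ?_ (le_walkProb (by linarith) (by linarith) hm k 0)
    refine sub_le_sub_left (le_trans ?_ hkε) 1
    rw [div_le_div_iff₀ (by positivity) (by positivity)]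
    push_cast
    nlinarith [show 0 ≤ (k : ℝ) ^ 2 * η ^ 4 by positivity]

theorem exists_obliviousR_le {ε : ℝ} (h0 : 0 < ε) (h1 : ε < 1 / 2) :
    ∃ C : ℝ, 0 < C ∧ ∀ (X : Type u) (Y : Type v) [Fintype X] [Fintype Y] (f : X → Y → Bool),
      (obliviousR ε f : ℝ) ≤ C * gammaTwo (commMatrix f) ^ 2 ∧
      (obliviousR ε f : ℝ) ≤ C * gammaTwo (signMatrix f) ^ 2 := by
  -- The factor `25 = 5²` comes from `t = 5γ₂`: doubling makes the bound on `γ₂` strict, and `2 ·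
  -- (2γ₂) + 1 ≤ 5γ₂` once `γ₂ ≥ 1`.
  refine ⟨(80000 / ε + 2) * 25, by positivity, fun X Y _ _ f => ?_⟩
  by_cases hf : ∃ x y, f x y = true
  · obtain ⟨x, y, hf⟩ := hf
    have hc : 1 ≤ gammaTwo (commMatrix f) :=
      one_le_gammaTwo (x := x) (y := y) (by simp [commMatrix, hf])
    have hs : 1 ≤ gammaTwo (signMatrix f) :=
      one_le_gammaTwo (x := x) (y := y) (by simp [signMatrix, hf])
    constructor
    · refine (obliviousR_le_of_hasGamma h0 h1 (t := 5 * gammaTwo (commMatrix f)) (by linarith)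
        ((hasGamma_signMatrix_of_commMatrix (hasGamma_of_gammaTwo_lt
          (t := 2 * gammaTwo (commMatrix f)) (by linarith))).mono (by linarith))).trans
        (le_of_eq (by ring))
    · refine (obliviousR_le_of_hasGamma h0 h1 (t := 5 * gammaTwo (signMatrix f)) (by linarith)
        (hasGamma_of_gammaTwo_lt (by linarith))).trans (le_of_eq (by ring))
  -- The bound `γ₂ ≥ 1` may fail when `f` has no 1-input, but then no communication is needed.
  · push Not at hf
    rw [obliviousR_eq_zero_of_const h0.le (by linarith) false
      fun x y => Bool.eq_false_iff.2 (hf x y), Nat.cast_zero]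
    constructor <;> positivity

end UpperBound

theorem mainTheorem2 (ε : ℝ) (hε₀ : 0 < ε) (hε₁ : ε < 1 / 2) :
    (∀ (X : Type u) (Y : Type v) [Fintype X] [Fintype Y] (f : X → Y → Bool),
      (ε ≤ 1 / 3 → Real.logb 2 (gammaTwo (commMatrix f)) ≤ (obliviousR ε f : ℝ)) ∧
      (ε ≤ 1 / 4 → Real.logb 2 (gammaTwo (signMatrix f)) ≤ (obliviousR ε f : ℝ)) ∧
      Real.logb 2 (gammaTwo (commMatrix f)) ≤
        (obliviousR ε f : ℝ) + Real.logb 2 (1 / (1 - 2 * ε)) ∧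
      Real.logb 2 (gammaTwo (signMatrix f)) ≤
        (obliviousR ε f : ℝ) + Real.logb 2 (1 / (1 - 2 * ε))) ∧
    ∃ C : ℝ, 0 < C ∧
      ∀ (X : Type u) (Y : Type v) [Fintype X] [Fintype Y] (f : X → Y → Bool),
        (obliviousR ε f : ℝ) ≤ C * gammaTwo (commMatrix f) ^ 2 ∧
        (obliviousR ε f : ℝ) ≤ C * gammaTwo (signMatrix f) ^ 2 :=
  ⟨fun _ _ _ _ f => logb_gammaTwo_le_obliviousR hε₀ hε₁ f, exists_obliviousR_le hε₀ hε₁⟩
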